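/- Let $H$ be a real Hilbert space and let $A:H\rightrightarrows H$ be a maximal monotone operator, with domain $D(A)=\{x\in H: Ax\neq\emptyset\}$ and zero set $S=A^{-1}0=\{x\in H: 0\in Ax\}$. For $x\in D(A)$ let $u_x:[0,\infty)\to H$ be the unique function, absolutely continuous on every compact interval, with $\dot u_x(t)\in -Au_x(t)$ for almost every $t>0$ and $u_x(0)=x$. For $t\ge 0$ let $S_t:\overline{D(A)}\to\overline{D(A)}$ be the extension by continuity of the map $x\mapsto u_x(t)$, $x\in D(A)$; $(S_t)_{t\ge0}$ is the semigroup generated by $A$. For $C\subset H$ nonempty, closed and convex let $P_C$ denote the orthogonal projection onto $C$. Theorem (Baillon–Brézis). Suppose that $S\neq\emptyset$ and let $x\in\overline{D(A)}$. Then $s\mapsto S_sx$ is integrable on $[0,t]$ for every $t>0$, the projections $P_S S_t x$ converge strongly, as $t\to\infty$, to some $v\in H$, and the averages $$\sigma_t x=\frac1t\int_0^t S_s x\,ds$$ converge weakly to the same $v$ as $t\to\infty$. -/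

import Mathlib

open Set Filter Topology MeasureTheory

noncomputable section

namespace MonotoneOperator

variable {H : Type*} [NormedAddCommGroup H] [InnerProductSpace ℝ H]

/-- The domain `D(A)` of a set-valued operator `A : H ⇉ H`. -/
def domain (A : H → Set H) : Set H := {x | (A x).Nonempty}

/-- The solution set `A⁻¹ 0`. -/
def zeros (A : H → Set H) : Set H := {x | (0 : H) ∈ A x}

/-- Monotonicity of a set-valued operator. -/
def IsMonotone (A : H → Set H) : Prop :=
  ∀ x y : H, ∀ x' ∈ A x, ∀ y' ∈ A y, 0 ≤ inner ℝ (x' - y') (x - y)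

/-- `A` is maximal monotone: it is monotone and no monotone operator has a strictly larger graph
(the order on `H → Set H` is inclusion of values at every point, that is, inclusion of graphs). -/
def IsMaximalMonotone (A : H → Set H) : Prop := Maximal IsMonotone A

/-- `u` is a solution of `u' ∈ -A u` a.e. on `(0, ∞)`, `u 0 = x`, absolutely continuous on every
compact interval `[0, T]`. Only the values of `u` on `[0, ∞)` matter. -/
structure IsSolution (A : H → Set H) (x : H) (u : ℝ → H) : Prop where
  absolutelyContinuous : ∀ T : ℝ, 0 ≤ T → AbsolutelyContinuousOnInterval u 0 T
  initial : u 0 = x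
  inclusion : ∀ᵐ t : ℝ, 0 < t → ∃ u' : H, HasDerivAt u u' t ∧ -u' ∈ A (u t)

open Classical in
/-- The map `x ↦ u(t)`, where `u` is the solution starting at `x ∈ D(A)` (the value where there
is no solution is irrelevant). -/
def solutionMap (A : H → Set H) (t : ℝ) (x : H) : H :=
  if h : ∃ u : ℝ → H, IsSolution A x u then h.choose t else 0

/-- The semigroup `S_t` generated by `A`: the extension by continuity of the solution map from
`D(A)` to its closure. -/
def semigroup (A : H → Set H) (t : ℝ) : H → H := extendFrom (domain A) (solutionMap A t)

/-- The Cesàro average `σ_t x = (1/t) ∫₀ᵗ S_s x ds` of the trajectory of `x`. -/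
def average (A : H → Set H) (t : ℝ) (x : H) : H :=
  (1 / t) • ∫ s in (0 : ℝ)..t, semigroup A s x

/-- The projection `P_C x` of `x` onto a nonempty closed convex subset `C` of a Hilbert space:
the point of `C` nearest to `x`. -/
def proj (C : Set H) (x : H) : H :=
  Classical.epsilon fun y => y ∈ C ∧ ∀ z ∈ C, ‖x - y‖ ≤ ‖x - z‖

end MonotoneOperator

end

/-!
The operator is treated as a relation, and everything is deduced from monotonicity together with one
use of maximality: a pair monotonically related to the whole graph lies in it
(`IsMaximalMonotone.mem_of_forall`). Weak compactness enters through limits along ultrafilters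
(`exists_weak_limit`), so no separability is needed.

*Generation.* Minty's theorem (`IsMaximalMonotone.exists_resolvent`) is first proved for finite
families, by minimizing a quadratic function over a simplex, and then in general by weak
compactness. It provides the resolvents `(I + r A)⁻¹`, whose iterates are implicit Euler schemes.
Kobayashi's estimate (`norm_iterate_resolvent_sub_le_sqrt`) makes the schemes with steps
`1 / (n + 1)` converge for `x ∈ D(A)` to a flow `u`. It satisfies `‖u b - u a‖ ≤ (b - a) ‖w‖` and an
energy inequality between the times `a ≤ b`, where `w` is the element of least norm of `A (u a)`.
The norm of that element does not increase in time. At a continuity point `t` of this norm, hence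
outside a countable set, the energy inequality puts the weak limit points of the difference
quotients of `u` in `-A (u t)`, while the Lipschitz bound limits their norms to the least possible
one; so the quotients converge strongly (`tendsto_neg_minimal_section`), and `u` is a solution
(`isSolution_flow`). Solutions are unique and nonexpansive in the initial value
(`IsSolution.norm_sub_le`), which identifies the semigroup with the extension of the flow to the
closure of `D(A)`.

*Asymptotics.* Distances of a trajectory to zeros of `A` do not increase, so the projections
`P_S S_t x` are Cauchy (`norm_proj_semigroup_sub_sq_le`) with a limit `v`. The integral inequality
divided by `t` (`neg_le_inner_average`) shows that every weak limit point `w` of the averages is a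
zero of `A`. The inequality `⟪S_t x - P_S S_t x, w - P_S S_t x⟫ ≤ 0`, averaged in time, gives in
the limit `⟪w - v, w - v⟫ ≤ 0`, so `w = v` (`eq_of_weak_limit_average`).
-/

open Set Filter Topology MeasureTheory

noncomputable section

namespace MonotoneOperator

section

variable {H : Type*} [NormedAddCommGroup H] [InnerProductSpace ℝ H]

/-! ### Weak limits and the graph of a maximal monotone operator -/

/-- Weak compactness of bounded sets: a bounded family converges weakly along every
ultrafilter. -/
theorem exists_weak_limit [CompleteSpace H] {ι : Type*} (l : Ultrafilter ι) (f : ι → H) {M : ℝ}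
    (hf : ∀ᶠ i in l, ‖f i‖ ≤ M) :
    ∃ w : H, ‖w‖ ≤ M ∧
      ∀ y, Tendsto (fun i => inner ℝ (f i) y) l (𝓝 (inner ℝ w y)) := by
  obtain ⟨i₀, hi₀⟩ := hf.exists
  have hM : 0 ≤ M := (norm_nonneg _).trans hi₀
  have hb : ∀ y, ∀ᶠ i in l, inner ℝ (f i) y ∈ Icc (-(M * ‖y‖)) (M * ‖y‖) := fun y => by
    filter_upwards [hf] with i hi
    exact abs_le.1 ((abs_real_inner_le_norm _ _).trans
      (mul_le_mul_of_nonneg_right hi (norm_nonneg _)))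
  have hlim : ∀ y, ∃ a, a ∈ Icc (-(M * ‖y‖)) (M * ‖y‖) ∧
      Tendsto (fun i => inner ℝ (f i) y) l (𝓝 a) := fun y => by
    obtain ⟨a, ha, h⟩ := isCompact_Icc.ultrafilter_le_nhds (l.map fun i => inner ℝ (f i) y)
      (le_principal_iff.2 (hb y))
    exact ⟨a, ha, h⟩
  choose φ hφ hlim using hlim
  let L : H →ₗ[ℝ] ℝ :=
    { toFun := φ
      map_add' := fun x y => by
        refine tendsto_nhds_unique (hlim (x + y)) ?_
        simpa only [inner_add_right] using (hlim x).add (hlim y)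
      map_smul' := fun c x => by
        refine tendsto_nhds_unique (hlim (c • x)) ?_
        simpa only [real_inner_smul_right, RingHom.id_apply, smul_eq_mul] using (hlim x).const_mul c }
  have hL : ∀ y, ‖L y‖ ≤ M * ‖y‖ := fun y => abs_le.2 (hφ y)
  refine ⟨(InnerProductSpace.toDual ℝ H).symm (L.mkContinuous M hL), ?_, fun y => ?_⟩
  · rw [LinearIsometryEquiv.norm_map]
    exact L.mkContinuous_norm_le hM hL
  · rw [InnerProductSpace.toDual_symm_apply]
    exact hlim y

/-- A point that is monotonically related to the whole graph belongs to the graph. -/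
theorem IsMaximalMonotone.mem_of_forall {A : H → Set H} (hA : IsMaximalMonotone A) {x w : H}
    (h : ∀ y, ∀ z ∈ A y, 0 ≤ inner ℝ (w - z) (x - y)) : w ∈ A x := by
  -- Adding `(x, w)` to the graph keeps it monotone.
  have hB : IsMonotone (fun p => A p ∪ {q | p = x ∧ q = w}) := by
    rintro p q p' (hp | ⟨rfl, rfl⟩) q' (hq | ⟨rfl, rfl⟩)
    · exact hA.1 p q p' hp q' hq
    · have := h p p' hp
      rwa [← neg_sub p' , ← neg_sub p, inner_neg_neg] at this
    · exact h q q' hq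
    · simp
  exact hA.2 hB (fun p q hq => Or.inl hq) x (Or.inr ⟨rfl, rfl⟩)

theorem IsMaximalMonotone.mem_iff {A : H → Set H} (hA : IsMaximalMonotone A) {x w : H} :
    w ∈ A x ↔ ∀ y, ∀ z ∈ A y, 0 ≤ inner ℝ (w - z) (x - y) :=
  ⟨fun hw _ _ hz => hA.1 _ _ _ hw _ hz, hA.mem_of_forall⟩

/-- The graph of a maximal monotone operator is closed for the strong topology on arguments and
the weak topology on bounded sets of values. -/
theorem IsMaximalMonotone.mem_of_tendsto {A : H → Set H} (hA : IsMaximalMonotone A)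
    {ι : Type*} {l : Filter ι} [l.NeBot] {u z : ι → H} {x w : H} {M : ℝ}
    (hu : Tendsto u l (𝓝 x)) (hz : ∀ᶠ i in l, ‖z i‖ ≤ M)
    (hw : ∀ y, Tendsto (fun i => inner ℝ (z i) y) l (𝓝 (inner ℝ w y)))
    (hmem : ∀ᶠ i in l, z i ∈ A (u i)) : w ∈ A x := by
  refine hA.mem_of_forall fun y q hq => ?_
  have h0 : Tendsto (fun i => inner ℝ (z i) (u i - x)) l (𝓝 0) := by
    have hnorm : Tendsto (fun i => M * ‖u i - x‖) l (𝓝 0) := by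
      simpa using (tendsto_iff_norm_sub_tendsto_zero.1 hu).const_mul M
    refine squeeze_zero_norm' ?_ hnorm
    filter_upwards [hz] with i hi
    exact (norm_inner_le_norm _ _).trans (mul_le_mul_of_nonneg_right hi (norm_nonneg _))
  have h1 : Tendsto (fun i => inner ℝ q (u i - y)) l (𝓝 (inner ℝ q (x - y))) :=
    (tendsto_const_nhds.inner (hu.sub_const y))
  have h2 := ((hw (x - y)).add h0).sub h1
  rw [add_zero, ← inner_sub_left] at h2
  refine ge_of_tendsto h2 ?_
  filter_upwards [hmem] with i hi
  have := hA.1 _ _ _ hi _ hq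
  rw [inner_sub_left] at this
  have e : x - y + (u i - x) = u i - y := by abel
  rwa [← inner_add_right, e]

/-- If arguments converge and the values stay bounded, the limit is in the domain, with a value
obeying the same bound. -/
theorem IsMaximalMonotone.exists_mem_of_tendsto [CompleteSpace H] {A : H → Set H}
    (hA : IsMaximalMonotone A) {ι : Type*} {l : Filter ι} [l.NeBot] {u : ι → H} {x : H} {M : ℝ}
    (hu : Tendsto u l (𝓝 x)) (h : ∀ᶠ i in l, ∃ z ∈ A (u i), ‖z‖ ≤ M) :
    ∃ w ∈ A x, ‖w‖ ≤ M := by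
  classical
  have hle : ((Ultrafilter.of l : Ultrafilter ι) : Filter ι) ≤ l := Ultrafilter.of_le l
  let z : ι → H := fun i => if hi : ∃ z ∈ A (u i), ‖z‖ ≤ M then hi.choose else 0
  have hz : ∀ᶠ i in l, z i ∈ A (u i) ∧ ‖z i‖ ≤ M := by
    filter_upwards [h] with i hi
    simp only [z, dif_pos hi]
    exact hi.choose_spec
  obtain ⟨w, hwM, hw⟩ := exists_weak_limit (Ultrafilter.of l) z
    (hle (hz.mono fun _ hi => hi.2))
  exact ⟨w, hA.mem_of_tendsto (hu.mono_left hle) (hle (hz.mono fun _ hi => hi.2)) hw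
    (hle (hz.mono fun _ hi => hi.1)), hwM⟩

/-! ### Surjectivity of `I + r A` -/

/-- For weights in the simplex, a monotone family has `∑ aᵢ ⟪zᵢ, yᵢ⟫ ≥ ⟪∑ aᵢ zᵢ, ∑ aᵢ yᵢ⟫`: the
difference is half of `∑ aᵢ aⱼ ⟪zᵢ - zⱼ, yᵢ - yⱼ⟫`. -/
theorem inner_sum_le_sum_inner {ι : Type*} [Fintype ι] {y z : ι → H}
    (hmono : ∀ i j, 0 ≤ inner ℝ (z i - z j) (y i - y j)) {a : ι → ℝ}
    (ha : a ∈ stdSimplex ℝ ι) :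
    inner ℝ (∑ i, a i • z i) (∑ i, a i • y i) ≤ ∑ i, a i * inner ℝ (z i) (y i) := by
  have h : 0 ≤ ∑ i, ∑ j, a i * (a j * inner ℝ (z i - z j) (y i - y j)) :=
    Finset.sum_nonneg fun i _ => Finset.sum_nonneg fun j _ =>
      mul_nonneg (ha.1 i) (mul_nonneg (ha.1 j) (hmono i j))
  have e : ∀ i j, a i * (a j * inner ℝ (z i - z j) (y i - y j)) =
      a j * (a i * inner ℝ (z i) (y i)) + a i * (a j * inner ℝ (z j) (y j))
        - a i * (a j * inner ℝ (z i) (y j)) - a i * (a j * inner ℝ (z j) (y i)) := fun i j => by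
    simp only [inner_sub_left, inner_sub_right]; ring
  have s1 : ∑ i, ∑ j, a j * (a i * inner ℝ (z i) (y i)) = ∑ i, a i * inner ℝ (z i) (y i) := by
    simp only [← Finset.sum_mul, ha.2, one_mul]
  have s2 : ∑ i, ∑ j, a i * (a j * inner ℝ (z j) (y j)) = ∑ i, a i * inner ℝ (z i) (y i) := by
    simp only [← Finset.mul_sum]
    rw [← Finset.sum_mul, ha.2, one_mul]
  have s3 : ∑ i, ∑ j, a i * (a j * inner ℝ (z i) (y j)) =
      inner ℝ (∑ i, a i • z i) (∑ i, a i • y i) := by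
    rw [Finset.sum_comm]
    simp only [sum_inner, inner_sum, real_inner_smul_left, real_inner_smul_right]
    exact Finset.sum_congr rfl fun i _ => Finset.sum_congr rfl fun j _ => by ring
  have s4 : ∑ i, ∑ j, a i * (a j * inner ℝ (z j) (y i)) =
      inner ℝ (∑ i, a i • z i) (∑ i, a i • y i) := by
    rw [Finset.sum_comm, ← s3]
    exact Finset.sum_congr rfl fun i _ => Finset.sum_congr rfl fun j _ => by ring
  simp only [e, Finset.sum_sub_distrib, Finset.sum_add_distrib, s1, s2, s3, s4] at h
  linarith

/-- The finite case of the surjectivity theorem. The functions `x ↦ ⟪x + zᵢ, x - yᵢ⟫` are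
`‖x‖² - 2 ⟪cᵢ, x⟫ - dᵢ` with `cᵢ = (yᵢ - zᵢ) / 2` and `dᵢ = ⟪zᵢ, yᵢ⟫`. The weights `a` minimizing
`‖∑ aᵢ cᵢ‖² + ∑ aᵢ dᵢ` over the simplex give the point `∑ aᵢ cᵢ`. -/
theorem exists_forall_inner_nonpos_of_fintype {ι : Type*} [Fintype ι] {y z : ι → H}
    (hmono : ∀ i j, 0 ≤ inner ℝ (z i - z j) (y i - y j)) :
    ∃ x, ∀ i, inner ℝ (x + z i) (x - y i) ≤ 0 := by
  classical
  rcases isEmpty_or_nonempty ι with hι | hι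
  · exact ⟨0, fun i => (hι.false i).elim⟩
  let c : (ι → ℝ) →ₗ[ℝ] H := Fintype.linearCombination ℝ fun i => (1 / 2 : ℝ) • (y i - z i)
  let d : (ι → ℝ) →ₗ[ℝ] ℝ := Fintype.linearCombination ℝ fun i => (inner ℝ (z i) (y i) : ℝ)
  have hc : Continuous c := c.continuous_on_pi
  have hd : Continuous d := d.continuous_on_pi
  obtain ⟨i₀⟩ := hι
  obtain ⟨a, ha, hmin⟩ := (isCompact_stdSimplex ℝ ι).exists_isMinOn
    ⟨_, single_mem_stdSimplex ℝ i₀⟩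
    (f := fun a => ‖c a‖ ^ 2 + d a) ((hc.norm.pow 2).add hd).continuousOn
  -- The value at the means `Y`, `Z` is at least `‖Y - Z‖² / 4 + ⟪Z, Y⟫ = ‖Y + Z‖² / 4`.
  have hnonneg : 0 ≤ ‖c a‖ ^ 2 + d a := by
    have h1 := inner_sum_le_sum_inner hmono ha
    have hca : c a = (1 / 2 : ℝ) • ((∑ i, a i • y i) - ∑ i, a i • z i) := by
      simp only [c, Fintype.linearCombination_apply, smul_sub, Finset.sum_sub_distrib,
        Finset.smul_sum, smul_comm (1 / 2 : ℝ)]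
    have hda : d a = ∑ i, a i * inner ℝ (z i) (y i) := by
      simp only [d, Fintype.linearCombination_apply, smul_eq_mul]
    set Y := ∑ i, a i • y i
    set Z := ∑ i, a i • z i
    have h2 : ‖c a‖ ^ 2 = (‖Y‖ ^ 2 - 2 * inner ℝ Z Y + ‖Z‖ ^ 2) / 4 := by
      rw [hca, norm_smul, mul_pow, norm_sub_sq_real, real_inner_comm]
      norm_num
      ring
    have h3 := norm_add_sq_real Z Y
    nlinarith [sq_nonneg ‖Z + Y‖]
  refine ⟨c a, fun j => ?_⟩
  let cj : H := (1 / 2 : ℝ) • (y j - z j)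
  let dj : ℝ := inner ℝ (z j) (y j)
  have hcj : c (Pi.single j 1) = cj := by
    simp [c, cj, Fintype.linearCombination_apply_single]
  have hdj : d (Pi.single j 1) = dj := by
    simp [d, dj, Fintype.linearCombination_apply_single]
  -- First-order optimality of `a` in the direction of the `j`-th vertex.
  have hopt : ∀ ε ∈ Ioo (0 : ℝ) 1,
      0 ≤ 2 * inner ℝ (c a) (cj - c a) + (dj - d a) + ε * ‖cj - c a‖ ^ 2 := by
    intro ε hε
    have hmem : (1 - ε) • a + ε • (Pi.single j 1 : ι → ℝ) ∈ stdSimplex ℝ ι :=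
      convex_stdSimplex ℝ ι ha (single_mem_stdSimplex ℝ j) (by linarith [hε.2]) hε.1.le (by ring)
    have h := hmin hmem
    simp only [mem_ofPred_eq, map_add, map_smul, hcj, hdj, smul_eq_mul] at h
    have e : (1 - ε) • c a + ε • cj = c a + ε • (cj - c a) := by module
    rw [e, norm_add_sq_real, real_inner_smul_right, norm_smul, mul_pow, Real.norm_eq_abs,
      sq_abs] at h
    have h' : 0 ≤ ε * (2 * inner ℝ (c a) (cj - c a) + (dj - d a) + ε * ‖cj - c a‖ ^ 2) := by
      linarith
    exact nonneg_of_mul_nonneg_right h' hε.1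
  -- Let `ε` tend to `0`.
  have hlim : 0 ≤ 2 * inner ℝ (c a) (cj - c a) + (dj - d a) := by
    have ht : Tendsto (fun ε : ℝ => 2 * inner ℝ (c a) (cj - c a) + (dj - d a) +
        ε * ‖cj - c a‖ ^ 2) (𝓝[>] 0) (𝓝 (2 * inner ℝ (c a) (cj - c a) + (dj - d a) +
        0 * ‖cj - c a‖ ^ 2)) := by
      refine Tendsto.mono_left (Continuous.tendsto ?_ 0) nhdsWithin_le_nhds
      fun_prop
    rw [zero_mul, add_zero] at ht
    exact ge_of_tendsto ht (by
      filter_upwards [Ioo_mem_nhdsGT (zero_lt_one (α := ℝ))] with ε hε using hopt ε hε)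
  have e1 : inner ℝ (c a + z j) (c a - y j) = ‖c a‖ ^ 2 - 2 * inner ℝ (c a) cj - dj := by
    simp only [cj, dj, inner_add_left, inner_sub_right, real_inner_smul_right,
      real_inner_self_eq_norm_sq, real_inner_comm (c a) (z j)]
    ring
  rw [inner_sub_right, real_inner_self_eq_norm_sq] at hlim
  rw [e1]
  linarith

/-- Every monotone subset of `H × H` has a point `x` with `(x, -x)` monotonically related to all
of its elements. -/
theorem exists_forall_inner_nonpos [CompleteSpace H] (G : Set (H × H))
    (hG : ∀ p ∈ G, ∀ q ∈ G, 0 ≤ inner ℝ (p.2 - q.2) (p.1 - q.1)) :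
    ∃ x, ∀ p ∈ G, inner ℝ (x + p.2) (x - p.1) ≤ 0 := by
  rcases G.eq_empty_or_nonempty with rfl | ⟨p₀, hp₀⟩
  · exact ⟨0, by simp⟩
  have hfin : ∀ I : Finset G, ∃ x, ∀ p ∈ I, inner ℝ (x + p.1.2) (x - p.1.1) ≤ 0 := fun I => by
    obtain ⟨x, hx⟩ := exists_forall_inner_nonpos_of_fintype (ι := I)
      (y := fun p => p.1.1.1) (z := fun p => p.1.1.2)
      (fun p q => hG _ p.1.2 _ q.1.2)
    exact ⟨x, fun p hp => hx ⟨p, hp⟩⟩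
  choose x hx using hfin
  let l : Ultrafilter (Finset G) := Ultrafilter.of atTop
  have hev : ∀ p : G, ∀ᶠ I in l, inner ℝ (x I + p.1.2) (x I - p.1.1) ≤ 0 := fun p => by
    refine Ultrafilter.of_le atTop ?_
    filter_upwards [eventually_ge_atTop {p}] with I hI
    exact hx I p (hI (Finset.mem_singleton_self p))
  have key : ∀ (v : H) (p : H × H), inner ℝ (v + p.2) (v - p.1) =
      ‖v‖ ^ 2 - inner ℝ v (p.1 - p.2) - inner ℝ p.2 p.1 := fun v p => by
    simp only [inner_add_left, inner_sub_right, real_inner_self_eq_norm_sq,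
      real_inner_comm v p.2]
    ring
  have hbdd : ∀ᶠ I in l, ‖x I‖ ≤ 2 * (‖p₀.1‖ + ‖p₀.2‖) := by
    filter_upwards [hev ⟨p₀, hp₀⟩] with I hI
    rw [key] at hI
    have h1 := (real_inner_le_norm (x I) (p₀.1 - p₀.2)).trans
      (mul_le_mul_of_nonneg_left (norm_sub_le p₀.1 p₀.2) (norm_nonneg _))
    have h2 := real_inner_le_norm p₀.2 p₀.1
    by_contra! hlt
    nlinarith [norm_nonneg p₀.1, norm_nonneg p₀.2, norm_nonneg (x I)]
  obtain ⟨w, -, hw⟩ := exists_weak_limit l x hbdd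
  refine ⟨w, fun p hp => ?_⟩
  -- Only the linear part passes to the weak limit; `0 ≤ ‖x I - w‖²` bounds the quadratic part
  -- from below.
  have ht := (((hw (p.1 - p.2)).add_const (inner ℝ p.2 p.1)).sub
    ((hw w).const_mul 2)).add_const (‖w‖ ^ 2)
  have hge := ge_of_tendsto (b := (0 : ℝ)) ht (by
    filter_upwards [hev ⟨p, hp⟩] with I hI
    rw [key] at hI
    have := norm_sub_sq_real (x I) w
    nlinarith [sq_nonneg ‖x I - w‖])
  rw [real_inner_self_eq_norm_sq] at hge
  rw [key]
  linarith

/-- Minty's theorem: `I + r A` is onto for `r > 0`. -/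
theorem IsMaximalMonotone.exists_resolvent [CompleteSpace H] {A : H → Set H}
    (hA : IsMaximalMonotone A) {r : ℝ} (hr : 0 < r) (f : H) :
    ∃ x, r⁻¹ • (f - x) ∈ A x := by
  -- The graph of `r A` translated by `f`.
  obtain ⟨w, hw⟩ := exists_forall_inner_nonpos
    {p : H × H | r⁻¹ • p.2 ∈ A (p.1 + f)} (fun p hp q hq => by
      have h := hA.1 _ _ _ hp _ hq
      rw [← smul_sub, real_inner_smul_left, add_sub_add_right_eq_sub] at h
      exact nonneg_of_mul_nonneg_right h (inv_pos.2 hr))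
  refine ⟨w + f, hA.mem_of_forall fun y z hz => ?_⟩
  have h := hw (y - f, r • z) (by simpa [smul_smul, hr.ne'] using hz)
  have e : r⁻¹ • (f - (w + f)) - z = -(r⁻¹ • (w + r • z)) := by
    rw [smul_add, smul_smul, inv_mul_cancel₀ hr.ne']
    module
  have e' : w + f - y = w - (y - f) := by abel
  rw [e, e', inner_neg_left, real_inner_smul_left]
  have := mul_nonpos_of_nonneg_of_nonpos (inv_pos.2 hr).le h
  linarith

/-! ### Resolvents and their iterates -/

/-- The resolvent `J_r = (I + r A)⁻¹`; meaningful for `r > 0`. -/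
def resolvent (A : H → Set H) (r : ℝ) (f : H) : H :=
  Classical.epsilon fun x => r⁻¹ • (f - x) ∈ A x

theorem resolvent_spec [CompleteSpace H] {A : H → Set H} (hA : IsMaximalMonotone A) {r : ℝ}
    (hr : 0 < r) (f : H) : r⁻¹ • (f - resolvent A r f) ∈ A (resolvent A r f) :=
  Classical.epsilon_spec (hA.exists_resolvent hr f)

/-- The resolvent relation is nonexpansive, hence single-valued. -/
theorem IsMonotone.norm_sub_le_of_mem {A : H → Set H} (hA : IsMonotone A) {r : ℝ} (hr : 0 < r)
    {f g p q : H} (hp : r⁻¹ • (f - p) ∈ A p) (hq : r⁻¹ • (g - q) ∈ A q) :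
    ‖p - q‖ ≤ ‖f - g‖ := by
  have h := hA _ _ _ hp _ hq
  rw [← smul_sub, real_inner_smul_left] at h
  have h1 := nonneg_of_mul_nonneg_right h (inv_pos.2 hr)
  have e : f - p - (g - q) = (f - g) - (p - q) := by abel
  rw [e, inner_sub_left, real_inner_self_eq_norm_sq] at h1
  have h2 := real_inner_le_norm (f - g) (p - q)
  by_contra! hlt
  nlinarith [norm_nonneg (f - g), norm_nonneg (p - q)]

variable [CompleteSpace H] {A : H → Set H}

theorem resolvent_eq_of_mem (hA : IsMaximalMonotone A) {r : ℝ} (hr : 0 < r) {f p : H}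
    (hp : r⁻¹ • (f - p) ∈ A p) : resolvent A r f = p := by
  have := hA.1.norm_sub_le_of_mem hr (resolvent_spec hA hr f) hp
  rw [sub_self, norm_zero] at this
  exact sub_eq_zero.1 (norm_le_zero_iff.1 this)

theorem norm_resolvent_sub_le (hA : IsMaximalMonotone A) {r : ℝ} (hr : 0 < r) (f g : H) :
    ‖resolvent A r f - resolvent A r g‖ ≤ ‖f - g‖ :=
  hA.1.norm_sub_le_of_mem hr (resolvent_spec hA hr f) (resolvent_spec hA hr g)

theorem norm_iterate_resolvent_sub_le (hA : IsMaximalMonotone A) {r : ℝ} (hr : 0 < r) (n : ℕ)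
    (f g : H) : ‖(resolvent A r)^[n] f - (resolvent A r)^[n] g‖ ≤ ‖f - g‖ := by
  induction n with
  | zero => simp
  | succ n ih =>
    rw [Function.iterate_succ_apply', Function.iterate_succ_apply']
    exact (norm_resolvent_sub_le hA hr _ _).trans ih

theorem norm_sub_resolvent_le (hA : IsMaximalMonotone A) {r : ℝ} (hr : 0 < r) {x z : H}
    (hz : z ∈ A x) : ‖x - resolvent A r x‖ ≤ r * ‖z‖ := by
  -- `x` is the resolvent of `x + r z`.
  have := hA.1.norm_sub_le_of_mem hr (f := x + r • z) (p := x)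
    (by simpa [smul_smul, hr.ne'] using hz) (resolvent_spec hA hr x)
  rwa [add_sub_cancel_left, norm_smul, Real.norm_of_nonneg hr.le] at this

theorem resolvent_identity (hA : IsMaximalMonotone A) {r s : ℝ} (hr : 0 < r) (hs : 0 < s)
    (x : H) :
    resolvent A s ((s / r) • x + (1 - s / r) • resolvent A r x) = resolvent A r x := by
  refine resolvent_eq_of_mem hA hs ?_
  have h := resolvent_spec hA hr x
  have e : (s / r) • x + (1 - s / r) • resolvent A r x - resolvent A r x =
      s • r⁻¹ • (x - resolvent A r x) := by
    rw [smul_smul, ← div_eq_mul_inv]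
    module
  rw [e, smul_smul, inv_mul_cancel₀ hs.ne', one_smul]
  exact h

/-- The minimal norm of the values does not increase along the resolvent iterates. -/
theorem exists_mem_iterate_resolvent (hA : IsMaximalMonotone A) {r : ℝ} (hr : 0 < r) {x z : H}
    (hz : z ∈ A x) (n : ℕ) : ∃ w ∈ A ((resolvent A r)^[n] x), ‖w‖ ≤ ‖z‖ := by
  induction n with
  | zero => exact ⟨z, hz, le_rfl⟩
  | succ n ih =>
    obtain ⟨w, hw, hwz⟩ := ih
    rw [Function.iterate_succ_apply']
    refine ⟨_, resolvent_spec hA hr _, ?_⟩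
    rw [norm_smul, norm_inv, Real.norm_of_nonneg hr.le, inv_mul_le_iff₀ hr]
    exact (norm_sub_resolvent_le hA hr hw).trans (mul_le_mul_of_nonneg_left hwz hr.le)

theorem norm_iterate_resolvent_add_sub_le (hA : IsMaximalMonotone A) {r : ℝ} (hr : 0 < r)
    {x z : H} (hz : z ∈ A x) (m k : ℕ) :
    ‖(resolvent A r)^[m + k] x - (resolvent A r)^[m] x‖ ≤ k * r * ‖z‖ := by
  induction k with
  | zero => simp
  | succ k ih =>
    obtain ⟨w, hw, hwz⟩ := exists_mem_iterate_resolvent hA hr hz (m + k)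
    have h := (norm_sub_resolvent_le hA hr hw).trans (mul_le_mul_of_nonneg_left hwz hr.le)
    rw [← add_assoc, Function.iterate_succ_apply']
    rw [norm_sub_rev] at h
    have := norm_sub_le_norm_sub_add_norm_sub (resolvent A r ((resolvent A r)^[m + k] x))
      ((resolvent A r)^[m + k] x) ((resolvent A r)^[m] x)
    push_cast
    linarith

theorem norm_iterate_resolvent_sub_iterate_le (hA : IsMaximalMonotone A) {r : ℝ} (hr : 0 < r)
    {x z : H} (hz : z ∈ A x) (m n : ℕ) :
    ‖(resolvent A r)^[m] x - (resolvent A r)^[n] x‖ ≤ |(m : ℝ) - n| * r * ‖z‖ := by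
  wlog h : n ≤ m generalizing m n
  · rw [norm_sub_rev, abs_sub_comm]
    exact this n m (le_of_not_ge h)
  obtain ⟨k, rfl⟩ := Nat.exists_eq_add_of_le h
  have := norm_iterate_resolvent_add_sub_le hA hr hz n k
  simpa using this

/-- The Crandall–Liggett estimate, in Kobayashi's form: the distance between the iterates of two
implicit Euler schemes with different step sizes. -/
theorem norm_iterate_resolvent_sub_le_sqrt (hA : IsMaximalMonotone A) {r s : ℝ} (hr : 0 < r)
    (hs : 0 < s) (hsr : s ≤ r) {x z : H} (hz : z ∈ A x) (m n : ℕ) :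
    ‖(resolvent A r)^[m] x - (resolvent A s)^[n] x‖ ≤
      ‖z‖ * √((m * r - n * s) ^ 2 + m * r ^ 2 + n * s ^ 2) := by
  induction n generalizing m with
  | zero =>
    have h := norm_iterate_resolvent_sub_iterate_le hA hr hz m 0
    simp only [Nat.cast_zero, sub_zero, Nat.abs_cast, Function.iterate_zero, id] at h ⊢
    rw [mul_comm] at h
    refine h.trans (mul_le_mul_of_nonneg_left (Real.le_sqrt_of_sq_le ?_) (norm_nonneg _))
    have : 0 ≤ (m : ℝ) * r ^ 2 := by positivity
    linarith
  | succ n ih =>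
    cases m with
    | zero =>
      have h := norm_iterate_resolvent_sub_iterate_le hA hs hz 0 (n + 1)
      rw [Nat.cast_zero, zero_sub, abs_neg, Nat.abs_cast, mul_comm] at h
      refine h.trans (mul_le_mul_of_nonneg_left (Real.le_sqrt_of_sq_le ?_) (norm_nonneg _))
      have : 0 ≤ ((n + 1 : ℕ) : ℝ) * s ^ 2 := by positivity
      push_cast at this ⊢
      nlinarith
    | succ m =>
      set p := s / r with hp
      have hp0 : 0 ≤ p := by positivity
      have hp1 : 0 ≤ 1 - p := by
        have : p ≤ 1 := (div_le_one hr).2 hsr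
        linarith
      have hpr : p * r = s := by rw [hp]; field_simp
      set a := (m * r - n * s) ^ 2 + m * r ^ 2 + n * s ^ 2
      set b := ((m + 1 : ℕ) * r - n * s) ^ 2 + (m + 1 : ℕ) * r ^ 2 + n * s ^ 2
      have ha : 0 ≤ a := by positivity
      have hb : 0 ≤ b := by positivity
      -- The resolvent identity expresses the step of size `r` as one of size `s`.
      have h1 : ‖(resolvent A r)^[m + 1] x - (resolvent A s)^[n + 1] x‖ ≤
          p * ‖(resolvent A r)^[m] x - (resolvent A s)^[n] x‖ +
            (1 - p) * ‖(resolvent A r)^[m + 1] x - (resolvent A s)^[n] x‖ := by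
        have e : (resolvent A r)^[m + 1] x = resolvent A s (p • (resolvent A r)^[m] x +
            (1 - p) • (resolvent A r)^[m + 1] x) := by
          rw [Function.iterate_succ_apply', resolvent_identity hA hr hs]
        rw [Function.iterate_succ_apply' (resolvent A s)]
        conv_lhs => rw [e]
        refine (norm_resolvent_sub_le hA hs _ _).trans ?_
        have e2 : p • (resolvent A r)^[m] x + (1 - p) • (resolvent A r)^[m + 1] x -
            (resolvent A s)^[n] x = p • ((resolvent A r)^[m] x - (resolvent A s)^[n] x) +
            (1 - p) • ((resolvent A r)^[m + 1] x - (resolvent A s)^[n] x) := by module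
        rw [e2]
        refine (norm_add_le _ _).trans_eq ?_
        rw [norm_smul, norm_smul, Real.norm_of_nonneg hp0, Real.norm_of_nonneg hp1]
      -- By concavity of the square root, it remains to compare the mean of the squared bounds
      -- with the new one: the mean is smaller by exactly `2 s²`.
      have h2 : p * √a + (1 - p) * √b ≤ √(p * a + (1 - p) * b) := by
        have := Real.strictConcaveOn_sqrt.concaveOn.2 ha hb hp0 hp1 (by ring)
        simpa only [smul_eq_mul] using this
      have h3 : √(p * a + (1 - p) * b) ≤ √(((m + 1 : ℕ) * r - (n + 1 : ℕ) * s) ^ 2 +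
          (m + 1 : ℕ) * r ^ 2 + (n + 1 : ℕ) * s ^ 2) := by
        apply Real.sqrt_le_sqrt
        have : p * a + (1 - p) * b = ((m + 1 : ℕ) * r - (n + 1 : ℕ) * s) ^ 2 +
            (m + 1 : ℕ) * r ^ 2 + (n + 1 : ℕ) * s ^ 2 - 2 * s ^ 2 := by
          simp only [a, b, ← hpr]
          push_cast
          ring
        rw [this]
        nlinarith [sq_nonneg s]
      calc _ ≤ _ := h1
        _ ≤ p * (‖z‖ * √a) + (1 - p) * (‖z‖ * √b) :=
          add_le_add (mul_le_mul_of_nonneg_left (ih m) hp0)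
            (mul_le_mul_of_nonneg_left (ih (m + 1)) hp1)
        _ = ‖z‖ * (p * √a + (1 - p) * √b) := by ring
        _ ≤ _ := mul_le_mul_of_nonneg_left (h2.trans h3) (norm_nonneg _)

end

section

variable {H : Type*} [NormedAddCommGroup H] [InnerProductSpace ℝ H] [CompleteSpace H]
  {A : H → Set H}

/-! ### The flow as a limit of implicit Euler schemes -/

/-- The implicit Euler scheme with step `1 / (n + 1)`, evaluated at time `t`. -/
def euler (A : H → Set H) (n : ℕ) (x : H) (t : ℝ) : H :=
  (resolvent A (1 / ((n : ℝ) + 1)))^[⌊t * ((n : ℝ) + 1)⌋₊] x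

/-- The limit of the implicit Euler schemes; it exists for `x` in the domain and `0 ≤ t`. -/
def flow (A : H → Set H) (x : H) (t : ℝ) : H := limUnder atTop fun n => euler A n x t

theorem floor_mul_le (n : ℕ) {t : ℝ} (ht : 0 ≤ t) :
    (⌊t * ((n : ℝ) + 1)⌋₊ : ℝ) * (1 / ((n : ℝ) + 1)) ≤ t := by
  have hn : (0 : ℝ) < (n : ℝ) + 1 := by positivity
  rw [mul_one_div, div_le_iff₀ hn]
  exact Nat.floor_le (by positivity)

theorem lt_floor_mul (n : ℕ) (t : ℝ) :
    t - 1 / ((n : ℝ) + 1) < (⌊t * ((n : ℝ) + 1)⌋₊ : ℝ) * (1 / ((n : ℝ) + 1)) := by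
  have hn : (0 : ℝ) < (n : ℝ) + 1 := by positivity
  rw [mul_one_div, lt_div_iff₀ hn, sub_mul, one_div_mul_cancel hn.ne']
  linarith [Nat.lt_floor_add_one (t * ((n : ℝ) + 1))]

theorem tendsto_floor_mul {t : ℝ} (ht : 0 ≤ t) :
    Tendsto (fun n : ℕ => (⌊t * ((n : ℝ) + 1)⌋₊ : ℝ) * (1 / ((n : ℝ) + 1))) atTop (𝓝 t) := by
  refine tendsto_of_tendsto_of_tendsto_of_le_of_le
    (g := fun n : ℕ => t - 1 / ((n : ℝ) + 1)) ?_ tendsto_const_nhds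
    (fun n => (lt_floor_mul n t).le) (fun n => floor_mul_le n ht)
  simpa using (tendsto_one_div_add_atTop_nhds_zero_nat (𝕜 := ℝ)).const_sub t

theorem cauchySeq_euler (hA : IsMaximalMonotone A) {x z : H} (hz : z ∈ A x) {t : ℝ}
    (ht : 0 ≤ t) : CauchySeq fun n => euler A n x t := by
  let δ : ℕ → ℝ := fun n => 1 / ((n : ℝ) + 1)
  have hδ : Tendsto δ atTop (𝓝 0) := tendsto_one_div_add_atTop_nhds_zero_nat
  refine cauchySeq_of_le_tendsto_0 (fun N => ‖z‖ * √(δ N ^ 2 + 2 * t * δ N)) ?_ ?_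
  · intro n m N hn hm
    wlog h : n ≤ m generalizing n m
    · rw [dist_comm]
      exact this m n hm hn (le_of_not_ge h)
    have hr : 0 < δ n := by positivity
    have hs : 0 < δ m := by positivity
    have hsr : δ m ≤ δ n := Nat.one_div_le_one_div h
    have hrN : δ n ≤ δ N := Nat.one_div_le_one_div hn
    rw [dist_eq_norm]
    refine (norm_iterate_resolvent_sub_le_sqrt hA hr hs hsr hz _ _).trans
      (mul_le_mul_of_nonneg_left (Real.sqrt_le_sqrt ?_) (norm_nonneg _))
    have a1 := floor_mul_le n ht
    have a2 := lt_floor_mul n t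
    have b1 := floor_mul_le m ht
    have b2 := lt_floor_mul m t
    change _ * δ n ≤ t at a1
    change t - δ n < _ * δ n at a2
    change _ * δ m ≤ t at b1
    change t - δ m < _ * δ m at b2
    have c1 : ((⌊t * ((n : ℝ) + 1)⌋₊ : ℝ) * δ n - ⌊t * ((m : ℝ) + 1)⌋₊ * δ m) ^ 2 ≤ δ N ^ 2 :=
      sq_le_sq' (by linarith) (by linarith)
    have c2 : (⌊t * ((n : ℝ) + 1)⌋₊ : ℝ) * δ n ^ 2 ≤ t * δ N := by
      rw [pow_two, ← mul_assoc]
      exact mul_le_mul a1 hrN hr.le ht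
    have c3 : (⌊t * ((m : ℝ) + 1)⌋₊ : ℝ) * δ m ^ 2 ≤ t * δ N := by
      rw [pow_two, ← mul_assoc]
      exact mul_le_mul b1 (hsr.trans hrN) hs.le ht
    linarith
  · have hc : Continuous fun a : ℝ => ‖z‖ * √(a ^ 2 + 2 * t * a) := by fun_prop
    simpa [Function.comp_def] using (hc.tendsto 0).comp hδ

theorem tendsto_euler (hA : IsMaximalMonotone A) {x : H} (hx : x ∈ domain A) {t : ℝ}
    (ht : 0 ≤ t) : Tendsto (fun n => euler A n x t) atTop (𝓝 (flow A x t)) :=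
  (cauchySeq_euler hA hx.some_mem ht).tendsto_limUnder

theorem flow_zero (hA : IsMaximalMonotone A) {x : H} (hx : x ∈ domain A) : flow A x 0 = x := by
  refine tendsto_nhds_unique (tendsto_euler hA hx le_rfl) ?_
  simp [euler]

theorem exists_mem_flow (hA : IsMaximalMonotone A) {x z : H} (hz : z ∈ A x) {t : ℝ}
    (ht : 0 ≤ t) : ∃ w ∈ A (flow A x t), ‖w‖ ≤ ‖z‖ :=
  hA.exists_mem_of_tendsto (tendsto_euler hA ⟨z, hz⟩ ht)
    (.of_forall fun n => exists_mem_iterate_resolvent hA (by positivity) hz _)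

theorem flow_mem_domain (hA : IsMaximalMonotone A) {x : H} (hx : x ∈ domain A) {t : ℝ}
    (ht : 0 ≤ t) : flow A x t ∈ domain A :=
  (exists_mem_flow hA hx.some_mem ht).imp fun _ h => h.1

theorem norm_flow_sub_flow_le (hA : IsMaximalMonotone A) {x z : H} (hz : z ∈ A x) {s t : ℝ}
    (hs : 0 ≤ s) (ht : 0 ≤ t) : ‖flow A x t - flow A x s‖ ≤ |t - s| * ‖z‖ := by
  have hx : x ∈ domain A := ⟨z, hz⟩
  refine le_of_tendsto_of_tendsto'
    ((tendsto_euler hA hx ht).sub (tendsto_euler hA hx hs)).norm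
    ((((tendsto_floor_mul ht).sub (tendsto_floor_mul hs)).abs).mul_const ‖z‖) fun n => ?_
  have hr : (0 : ℝ) < 1 / ((n : ℝ) + 1) := by positivity
  refine (norm_iterate_resolvent_sub_iterate_le hA hr hz _ _).trans_eq ?_
  rw [← sub_mul, abs_mul, abs_of_pos hr]

theorem flow_add (hA : IsMaximalMonotone A) {x : H} (hx : x ∈ domain A) {s t : ℝ} (hs : 0 ≤ s)
    (ht : 0 ≤ t) : flow A x (s + t) = flow A (flow A x s) t := by
  obtain ⟨z, hz⟩ := id hx
  have h1 : Tendsto (fun n => euler A n (flow A x s) t) atTop (𝓝 (flow A (flow A x s) t)) :=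
    tendsto_euler hA (flow_mem_domain hA hx hs) ht
  have h2 : Tendsto (fun n => euler A n (euler A n x s) t - euler A n (flow A x s) t) atTop
      (𝓝 0) := by
    refine squeeze_zero_norm (fun n => norm_iterate_resolvent_sub_le hA (by positivity) _ _ _) ?_
    exact tendsto_iff_norm_sub_tendsto_zero.1 (tendsto_euler hA hx hs)
  -- The numbers of steps for `s + t` and for `s` followed by `t` agree in the limit.
  have h3 : Tendsto (fun n => euler A n x (s + t) - euler A n (euler A n x s) t) atTop
      (𝓝 0) := by
    have hlim := (((tendsto_floor_mul (add_nonneg hs ht)).sub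
      ((tendsto_floor_mul ht).add (tendsto_floor_mul hs))).abs).mul_const ‖z‖
    rw [add_comm t s, sub_self, abs_zero, zero_mul] at hlim
    refine squeeze_zero_norm (fun n => ?_) hlim
    have hr : (0 : ℝ) < 1 / ((n : ℝ) + 1) := by positivity
    have h := norm_iterate_resolvent_sub_iterate_le hA hr hz ⌊(s + t) * ((n : ℝ) + 1)⌋₊
      (⌊t * ((n : ℝ) + 1)⌋₊ + ⌊s * ((n : ℝ) + 1)⌋₊)
    rw [Function.iterate_add_apply] at h
    refine h.trans_eq ?_
    rw [← add_mul, ← sub_mul, abs_mul, abs_of_pos hr]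
    push_cast
    rfl
  refine tendsto_nhds_unique (tendsto_euler hA hx (add_nonneg hs ht)) ?_
  simpa using (h3.add h2).add h1

/-- The energy inequality for the implicit Euler scheme, with an error quadratic in time. -/
theorem energy_iterate_resolvent (hA : IsMaximalMonotone A) {r : ℝ} (hr : 0 < r) {x z y q : H}
    (hz : z ∈ A x) (hq : q ∈ A y) (k : ℕ) :
    ‖(resolvent A r)^[k] x - y‖ ^ 2 / 2 - ‖x - y‖ ^ 2 / 2 ≤
      -(k * r) * inner ℝ q (x - y) + ‖q‖ * ‖z‖ * (k * r) ^ 2 := by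
  induction k with
  | zero => simp
  | succ k ih =>
    have hd := norm_iterate_resolvent_sub_iterate_le hA hr hz (k + 1) 0
    rw [Function.iterate_succ_apply'] at hd ⊢
    simp only [Nat.cast_zero, sub_zero, Nat.abs_cast, Function.iterate_zero, id] at hd
    set a := (resolvent A r)^[k] x
    have hm := hA.1 _ _ _ (resolvent_spec hA hr a) _ hq
    set b := resolvent A r a
    rw [inner_sub_left, real_inner_smul_left] at hm
    have h1 : inner ℝ (a - b) (b - y) ≤ ‖a - y‖ ^ 2 / 2 - ‖b - y‖ ^ 2 / 2 := by
      have e : a - y = (a - b) + (b - y) := by abel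
      rw [e, norm_add_sq_real]
      nlinarith [sq_nonneg ‖a - b‖]
    have h2 : r * inner ℝ q (b - y) ≤ inner ℝ (a - b) (b - y) := by
      rw [sub_nonneg, ← div_eq_inv_mul, le_div_iff₀ hr] at hm
      linarith
    have h3 : -inner ℝ q (b - y) ≤ -inner ℝ q (x - y) + ‖q‖ * ((k + 1 : ℕ) * r * ‖z‖) := by
      have e : inner ℝ q (b - y) = inner ℝ q (x - y) + inner ℝ q (b - x) := by
        rw [← inner_add_right]; congr 1; abel
      have := (neg_le_of_abs_le (abs_real_inner_le_norm q (b - x)))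
      have := mul_le_mul_of_nonneg_left hd (norm_nonneg q)
      linarith
    have h4 := mul_le_mul_of_nonneg_left h3 hr.le
    have h5 : 0 ≤ ‖q‖ * ‖z‖ * (k * r ^ 2) := by positivity
    push_cast at h4 ⊢
    nlinarith

theorem energy_flow (hA : IsMaximalMonotone A) {x z y q : H} (hz : z ∈ A x) (hq : q ∈ A y)
    {t : ℝ} (ht : 0 ≤ t) :
    ‖flow A x t - y‖ ^ 2 / 2 - ‖x - y‖ ^ 2 / 2 ≤
      -t * inner ℝ q (x - y) + ‖q‖ * ‖z‖ * t ^ 2 := by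
  have hk := tendsto_floor_mul ht
  exact le_of_tendsto_of_tendsto'
    (((((tendsto_euler hA ⟨z, hz⟩ ht).sub_const y).norm.pow 2).div_const 2).sub_const _)
    ((hk.neg.mul_const _).add ((hk.pow 2).const_mul _))
    fun n => energy_iterate_resolvent hA (by positivity) hz hq _

/-! ### Differentiability of the flow -/

/-- The set `A x` has an element of least norm, described by its variational inequality. -/
theorem exists_minimal_section (hA : IsMaximalMonotone A) {x : H} (hx : x ∈ domain A) :
    ∃ w ∈ A x, ∀ z ∈ A x, ‖w‖ ^ 2 ≤ inner ℝ w z := by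
  have hset : A x = ⋂ (y : H) (z ∈ A y), {w | 0 ≤ inner ℝ (w - z) (x - y)} := by
    ext w
    simp only [mem_iInter]
    exact hA.mem_iff
  have hclosed : IsClosed (A x) := by
    rw [hset]
    refine isClosed_iInter fun y => isClosed_iInter fun z => isClosed_iInter fun _ => ?_
    exact isClosed_le continuous_const (by fun_prop)
  have hconv : Convex ℝ (A x) := by
    rw [hset]
    refine convex_iInter fun y => convex_iInter fun z => convex_iInter fun _ => ?_
    intro a ha b hb α β hα hβ hαβ
    have e : α • a + β • b - z = α • (a - z) + β • (b - z) := by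
      obtain rfl : β = 1 - α := by linarith
      module
    change 0 ≤ inner ℝ (α • a + β • b - z) (x - y)
    rw [e, inner_add_left, real_inner_smul_left, real_inner_smul_left]
    exact add_nonneg (mul_nonneg hα ha) (mul_nonneg hβ hb)
  obtain ⟨w, hw, hmin⟩ := exists_norm_eq_iInf_of_complete_convex hx hclosed.isComplete hconv 0
  refine ⟨w, hw, fun z hz => ?_⟩
  have := (norm_eq_iInf_iff_real_inner_le_zero hconv hw).1 hmin z hz
  rw [zero_sub, inner_neg_left, inner_sub_right, real_inner_self_eq_norm_sq] at this
  linarith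

/-- A family asymptotically satisfying `⟪q, p - y⟫ ≤ -⟪z, p - y⟫` for all `z ∈ A y` has its weak
limit points in `-A p`. If also its norms are asymptotically at most that of the least-norm element
`w` of `A p`, it converges strongly to `-w`. -/
theorem tendsto_neg_minimal_section (hA : IsMaximalMonotone A) {p w : H}
    (hmin : ∀ z ∈ A p, ‖w‖ ^ 2 ≤ inner ℝ w z) {ι : Type*} {l : Filter ι} {q : ι → H}
    {M : ι → ℝ} (hM : Tendsto M l (𝓝 ‖w‖)) (hqM : ∀ᶠ i in l, ‖q i‖ ≤ M i)
    (hq : ∀ y, ∀ z ∈ A y, ∃ err : ι → ℝ, Tendsto err l (𝓝 0) ∧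
      ∀ᶠ i in l, inner ℝ (q i) (p - y) ≤ -inner ℝ z (p - y) + err i) :
    Tendsto q l (𝓝 (-w)) := by
  rw [tendsto_iff_ultrafilter]
  intro g hg
  -- Along the ultrafilter, a weak limit `v` satisfies `-v ∈ A p`, and then `‖q + w‖² → 0`.
  have hbdd : ∀ᶠ i in (g : Filter ι), ‖q i‖ ≤ ‖w‖ + 1 := hg <| by
    filter_upwards [hqM, hM.eventually (gt_mem_nhds (lt_add_one ‖w‖))] with i h1 h2
    exact h1.trans h2.le
  obtain ⟨v, -, hv⟩ := exists_weak_limit g q hbdd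
  have hvA : -v ∈ A p := by
    refine hA.mem_of_forall fun y z hz => ?_
    obtain ⟨err, herr, hle⟩ := hq y z hz
    have := le_of_tendsto_of_tendsto (hv (p - y)) ((herr.mono_left hg).const_add _) (hg hle)
    rw [inner_sub_left, inner_neg_left]
    linarith
  have h1 := hmin _ hvA
  rw [inner_neg_right, real_inner_comm] at h1
  have hup : Tendsto (fun i => M i ^ 2 + 2 * inner ℝ (q i) w + ‖w‖ ^ 2) g
      (𝓝 (‖w‖ ^ 2 + 2 * inner ℝ v w + ‖w‖ ^ 2)) :=
    (((hM.mono_left hg).pow 2).add ((hv w).const_mul 2)).add_const _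
  have hle : ∀ᶠ i in (g : Filter ι), ‖q i + w‖ ^ 2 ≤ M i ^ 2 + 2 * inner ℝ (q i) w + ‖w‖ ^ 2 :=
    hg <| by
      filter_upwards [hqM] with i hi
      rw [norm_add_sq_real]
      have := pow_le_pow_left₀ (norm_nonneg _) hi 2
      linarith
  have hzero : ‖w‖ ^ 2 + 2 * inner ℝ v w + ‖w‖ ^ 2 = 0 :=
    le_antisymm (by linarith)
      (ge_of_tendsto hup (hle.mono fun i hi => (sq_nonneg _).trans hi))
  rw [hzero] at hup
  have hsq := squeeze_zero' (.of_forall fun i => sq_nonneg ‖q i + w‖) hle hup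
  have hnorm : Tendsto (fun i => ‖q i + w‖) g (𝓝 0) := by
    simpa [Real.sqrt_sq] using hsq.sqrt
  rw [tendsto_iff_norm_sub_tendsto_zero]
  simpa using hnorm

/-- Existence of solutions: the flow solves the evolution equation. Its derivative is minus the
least-norm section at each continuity point of the nonincreasing norm of that section, hence
outside a countable set. -/
theorem isSolution_flow (hA : IsMaximalMonotone A) {x : H} (hx : x ∈ domain A) :
    IsSolution A x (flow A x) := by
  have hdom : ∀ t : ℝ, 0 ≤ t → ∃ w ∈ A (flow A x t), ∀ z ∈ A (flow A x t), ‖w‖ ^ 2 ≤ inner ℝ w z :=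
    fun t ht => exists_minimal_section hA (flow_mem_domain hA hx ht)
  choose! w hw hmin using hdom
  set u := flow A x with hu
  have hnext : ∀ a b : ℝ, 0 ≤ a → a ≤ b → u b = flow A (u a) (b - a) := fun a b ha hab => by
    rw [hu, ← flow_add hA hx ha (sub_nonneg.2 hab), add_sub_cancel]
  -- The value of `A` at a later time provided by the flow is no larger than the least one earlier.
  have hanti : AntitoneOn (fun t => ‖w t‖) (Ici 0) := by
    intro a ha b hb hab
    obtain ⟨v, hv, hva⟩ := exists_mem_flow hA (hw a ha) (sub_nonneg.2 hab)
    rw [← hnext a b ha hab] at hv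
    refine le_trans ?_ hva
    have h1 := (hmin b hb v hv).trans (real_inner_le_norm _ _)
    by_contra! hlt
    nlinarith [norm_nonneg v]
  have hlip : ∀ a b : ℝ, 0 ≤ a → a ≤ b → ‖u b - u a‖ ≤ (b - a) * ‖w a‖ := fun a b ha hab => by
    have h := norm_flow_sub_flow_le hA (hw a ha) le_rfl (sub_nonneg.2 hab)
    rwa [← hnext a b ha hab, flow_zero hA ⟨_, hw a ha⟩, sub_zero,
      abs_of_nonneg (sub_nonneg.2 hab)] at h
  have henergy : ∀ a b : ℝ, 0 ≤ a → a ≤ b → ∀ y, ∀ z ∈ A y,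
      ‖u b - y‖ ^ 2 / 2 - ‖u a - y‖ ^ 2 / 2 ≤
        -(b - a) * inner ℝ z (u a - y) + ‖z‖ * ‖w a‖ * (b - a) ^ 2 :=
    fun a b ha hab y z hz => by
      rw [hnext a b ha hab]
      exact energy_flow hA (hw a ha) hz (sub_nonneg.2 hab)
  refine ⟨fun T hT => ?_, flow_zero hA hx, ?_⟩
  · refine LipschitzOnWith.absolutelyContinuousOnInterval (K := ‖w 0‖₊) ?_
    rw [uIcc_of_le hT]
    refine LipschitzOnWith.of_dist_le_mul fun a ha b hb => ?_
    have hz := hw 0 le_rfl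
    rw [hu, flow_zero hA hx] at hz
    rw [dist_eq_norm, Real.dist_eq, mul_comm]
    exact norm_flow_sub_flow_le hA hz hb.1 ha.1
  have hcount := hanti.countable_not_continuousWithinAt.ae_notMem volume
  filter_upwards [hcount] with t htc ht
  have hcont : ContinuousWithinAt (fun t => ‖w t‖) (Ici 0) t := by
    by_contra h
    exact htc ⟨ht.le, h⟩
  refine ⟨-w t, ?_, by simpa using hw t ht.le⟩
  rw [hasDerivAt_iff_tendsto_slope]
  have hpos : ∀ᶠ s in 𝓝[≠] t, 0 < s := nhdsWithin_le_nhds (lt_mem_nhds ht)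
  have hne : ∀ᶠ s in 𝓝[≠] t, s ≠ t := eventually_mem_nhdsWithin
  -- A difference quotient between `s` and `t` is bounded by the least norm at the earlier time.
  refine tendsto_neg_minimal_section hA (hmin t ht.le) (M := fun s => ‖w (min s t)‖) ?_ ?_ ?_
  · refine hcont.tendsto.comp (tendsto_nhdsWithin_iff.2 ⟨?_, ?_⟩)
    · have : Tendsto (fun s => min s t) (𝓝 t) (𝓝 (min t t)) :=
        (continuous_id.min continuous_const).tendsto t
      rw [min_self] at this
      exact this.mono_left nhdsWithin_le_nhds
    · filter_upwards [hpos] with s hs using le_min hs.le ht.le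
  · filter_upwards [hpos, hne] with s hs hst
    rw [slope_def_module, norm_smul, norm_inv, Real.norm_eq_abs,
      inv_mul_le_iff₀ (abs_pos.2 (sub_ne_zero.2 hst))]
    rcases le_total s t with h | h
    · rw [min_eq_left h, norm_sub_rev, abs_sub_comm, abs_of_nonneg (sub_nonneg.2 h)]
      exact hlip s t hs.le h
    · rw [min_eq_right h, abs_of_nonneg (sub_nonneg.2 h)]
      exact hlip t s ht.le h
  · intro y z hz
    -- For `s < t` the energy inequality is centred at `u s`; moving it to `u t` costs the terms
    -- `‖u t - u s‖² / 2` and `‖z‖ ‖u t - u s‖`.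
    let C := ‖w 0‖ ^ 2 / 2 + 2 * (‖z‖ * ‖w 0‖)
    refine ⟨fun s => |s - t| * C, ?_, ?_⟩
    · have : Continuous fun s => |s - t| * C := by fun_prop
      have h := (this.tendsto t).mono_left (nhdsWithin_le_nhds (s := {t}ᶜ))
      simpa using h
    filter_upwards [hpos, hne] with s hs hst
    rw [slope_def_module, real_inner_smul_left]
    rcases lt_or_gt_of_ne hst with h | h
    · have hd : 0 < t - s := sub_pos.2 h
      have hw0 : ‖w s‖ ≤ ‖w 0‖ := hanti self_mem_Ici hs.le hs.le
      have h1 := henergy s t hs.le h.le y z hz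
      have h2 : ‖u t - u s‖ ≤ (t - s) * ‖w 0‖ :=
        (hlip s t hs.le h.le).trans (mul_le_mul_of_nonneg_left hw0 hd.le)
      have e1 : ‖u s - y‖ ^ 2 = ‖u t - y‖ ^ 2 - 2 * inner ℝ (u t - u s) (u t - y) +
          ‖u t - u s‖ ^ 2 := by
        rw [real_inner_comm, ← norm_sub_sq_real]; congr 2; abel
      have e2 : inner ℝ z (u s - y) = inner ℝ z (u t - y) - inner ℝ z (u t - u s) := by
        rw [← inner_sub_right]; congr 1; abel
      have h3 : inner ℝ z (u t - u s) ≤ ‖z‖ * ((t - s) * ‖w 0‖) :=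
        (real_inner_le_norm _ _).trans (mul_le_mul_of_nonneg_left h2 (norm_nonneg _))
      have h4 := pow_le_pow_left₀ (norm_nonneg _) h2 2
      have h5 : ‖z‖ * ‖w s‖ * (t - s) ^ 2 ≤ ‖z‖ * ‖w 0‖ * (t - s) ^ 2 := by gcongr
      have h6 := mul_le_mul_of_nonneg_left h3 hd.le
      have e3 : (s - t)⁻¹ * inner ℝ (u s - u t) (u t - y) =
          (t - s)⁻¹ * inner ℝ (u t - u s) (u t - y) := by
        rw [← neg_sub (u t), ← neg_sub t s, inner_neg_left, inv_neg, neg_mul_neg]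
      rw [e3, abs_of_neg (sub_neg.2 h), inv_mul_le_iff₀ hd]
      rw [e1, e2] at h1
      simp only [C]
      nlinarith
    · have hd : 0 < s - t := sub_pos.2 h
      have hw0 : ‖w t‖ ≤ ‖w 0‖ := hanti self_mem_Ici ht.le ht.le
      have h1 := henergy t s ht.le h.le y z hz
      have e1 : ‖u s - y‖ ^ 2 = ‖u s - u t‖ ^ 2 + 2 * inner ℝ (u s - u t) (u t - y) +
          ‖u t - y‖ ^ 2 := by
        rw [← norm_add_sq_real, sub_add_sub_cancel]
      have h5 : ‖z‖ * ‖w t‖ * (s - t) ^ 2 ≤ ‖z‖ * ‖w 0‖ * (s - t) ^ 2 := by gcongr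
      have h6 : 0 ≤ ‖z‖ * ‖w 0‖ * (s - t) ^ 2 := by positivity
      have h7 : 0 ≤ ‖w 0‖ ^ 2 * (s - t) ^ 2 := by positivity
      rw [abs_of_pos hd, inv_mul_le_iff₀ hd]
      rw [e1] at h1
      simp only [C]
      nlinarith [sq_nonneg ‖u s - u t‖]

end

section

/-! ### Uniqueness and the integral inequality for solutions -/

theorem absolutelyContinuousOnInterval_norm {E : Type*} [SeminormedAddCommGroup E] {f : ℝ → E}
    {a b : ℝ} (hf : AbsolutelyContinuousOnInterval f a b) :
    AbsolutelyContinuousOnInterval (fun t => ‖f t‖) a b := by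
  rw [absolutelyContinuousOnInterval_iff] at hf ⊢
  intro ε hε
  obtain ⟨δ, hδ, h⟩ := hf ε hε
  refine ⟨δ, hδ, fun E hE hlt => (Finset.sum_le_sum fun i _ => ?_).trans_lt (h E hE hlt)⟩
  rw [Real.dist_eq, dist_eq_norm]
  exact abs_norm_sub_norm_le _ _

theorem sub_le_integral_of_ae_deriv_le {f g : ℝ → ℝ} {t : ℝ} (ht : 0 ≤ t)
    (hf : AbsolutelyContinuousOnInterval f 0 t) (hg : IntervalIntegrable g volume 0 t)
    (h : ∀ᵐ s : ℝ, 0 < s → deriv f s ≤ g s) : f t - f 0 ≤ ∫ s in (0 : ℝ)..t, g s := by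
  rw [← hf.integral_deriv_eq_sub]
  refine intervalIntegral.integral_mono_ae_restrict ht hf.intervalIntegrable_deriv hg ?_
  refine (ae_restrict_iff' measurableSet_Icc).2 ?_
  filter_upwards [h, compl_mem_ae_iff.2 (measure_singleton (0 : ℝ))] with s hs hs0 hmem
  exact hs (lt_of_le_of_ne hmem.1 (Ne.symm hs0))

theorem absolutelyContinuousOnInterval_norm_sq {E : Type*} [SeminormedAddCommGroup E]
    {f : ℝ → E} {a b : ℝ} (hf : AbsolutelyContinuousOnInterval f a b) :
    AbsolutelyContinuousOnInterval (fun t => ‖f t‖ ^ 2) a b := by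
  have h := absolutelyContinuousOnInterval_norm hf
  simpa only [pow_two] using h.fun_mul h

variable {H : Type*} [NormedAddCommGroup H] [InnerProductSpace ℝ H] {A : H → Set H}

theorem IsSolution.continuousOn {x : H} {u : ℝ → H} (hu : IsSolution A x u) {t : ℝ}
    (ht : 0 ≤ t) : ContinuousOn u (Icc 0 t) := by
  simpa [uIcc_of_le ht] using (hu.absolutelyContinuous t ht).continuousOn

/-- Solutions depend nonexpansively on their initial values. -/
theorem IsSolution.norm_sub_le (hA : IsMonotone A) {x y : H} {u v : ℝ → H}
    (hu : IsSolution A x u) (hv : IsSolution A y v) {t : ℝ} (ht : 0 ≤ t) :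
    ‖u t - v t‖ ≤ ‖x - y‖ := by
  have hac := absolutelyContinuousOnInterval_norm_sq
    ((hu.absolutelyContinuous t ht).fun_sub (hv.absolutelyContinuous t ht))
  have h := sub_le_integral_of_ae_deriv_le ht hac (g := fun _ => 0)
    intervalIntegrable_const (by
      filter_upwards [hu.inclusion, hv.inclusion] with s h1 h2 hs
      obtain ⟨u', hu', hum⟩ := h1 hs
      obtain ⟨v', hv', hvm⟩ := h2 hs
      rw [(hu'.fun_sub hv').norm_sq.deriv]
      have := hA _ _ _ hum _ hvm
      have e : -u' - -v' = -(u' - v') := by abel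
      rw [e, inner_neg_left, real_inner_comm] at this
      linarith)
  rw [intervalIntegral.integral_zero, hu.initial, hv.initial, sub_nonpos] at h
  exact le_of_sq_le_sq h (norm_nonneg _)

/-- The integral inequality: solutions are integral solutions in the sense of Bénilan. -/
theorem IsSolution.energy_le (hA : IsMonotone A) {x y q : H} {u : ℝ → H}
    (hu : IsSolution A x u) (hq : q ∈ A y) {t : ℝ} (ht : 0 ≤ t) :
    ‖u t - y‖ ^ 2 - ‖x - y‖ ^ 2 ≤ ∫ s in (0 : ℝ)..t, 2 * inner ℝ q (y - u s) := by
  have hac := absolutelyContinuousOnInterval_norm_sq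
    ((hu.absolutelyContinuous t ht).fun_sub
      (LipschitzOnWith.absolutelyContinuousOnInterval
        ((LipschitzWith.const y).lipschitzOnWith (s := uIcc 0 t))))
  have hcont := hu.continuousOn ht
  have hint : IntervalIntegrable (fun s => 2 * inner ℝ q (y - u s)) volume 0 t := by
    refine ContinuousOn.intervalIntegrable ?_
    rw [uIcc_of_le ht]
    exact continuousOn_const.mul (continuousOn_const.inner (continuousOn_const.sub hcont))
  have h := sub_le_integral_of_ae_deriv_le ht hac hint (by
      filter_upwards [hu.inclusion] with s h1 hs
      obtain ⟨u', hu', hum⟩ := h1 hs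
      rw [(hu'.sub_const y).norm_sq.deriv]
      have := hA _ _ _ hum _ hq
      rw [inner_sub_left, inner_neg_left, real_inner_comm] at this
      rw [← neg_sub (u s) y, inner_neg_right]
      linarith)
  simpa only [hu.initial] using h

/-! ### The semigroup on the closure of the domain -/

variable [CompleteSpace H]

theorem solutionMap_eq_flow (hA : IsMaximalMonotone A) {x : H} (hx : x ∈ domain A) {t : ℝ}
    (ht : 0 ≤ t) : solutionMap A t x = flow A x t := by
  have h : ∃ u : ℝ → H, IsSolution A x u := ⟨_, isSolution_flow hA hx⟩
  have := h.choose_spec.norm_sub_le hA.1 (isSolution_flow hA hx) ht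
  rw [sub_self, norm_zero, norm_le_zero_iff, sub_eq_zero] at this
  rw [solutionMap, dif_pos h, this]

theorem norm_flow_sub_le (hA : IsMaximalMonotone A) {x y : H} (hx : x ∈ domain A)
    (hy : y ∈ domain A) {t : ℝ} (ht : 0 ≤ t) : ‖flow A x t - flow A y t‖ ≤ ‖x - y‖ :=
  (isSolution_flow hA hx).norm_sub_le hA.1 (isSolution_flow hA hy) ht

/-- The flow is nonexpansive in the initial value, so the limit defining its extension to the
closure of the domain exists. -/
theorem tendsto_semigroup (hA : IsMaximalMonotone A) {x : H} (hx : x ∈ closure (domain A))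
    {t : ℝ} (ht : 0 ≤ t) :
    Tendsto (fun y => flow A y t) (𝓝[domain A] x) (𝓝 (semigroup A t x)) := by
  have : (𝓝[domain A] x).NeBot := mem_closure_iff_nhdsWithin_neBot.1 hx
  have heq : solutionMap A t =ᶠ[𝓝[domain A] x] fun y => flow A y t := by
    filter_upwards [eventually_mem_nhdsWithin] with y hy using solutionMap_eq_flow hA hy ht
  have hc : Cauchy (map (fun y => flow A y t) (𝓝[domain A] x)) := by
    refine Metric.cauchy_iff.2 ⟨inferInstance, fun ε hε => ?_⟩
    refine ⟨_, image_mem_map (inter_mem_nhdsWithin _ (Metric.ball_mem_nhds x (half_pos hε))), ?_⟩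
    rintro _ ⟨a, ⟨ha, hax⟩, rfl⟩ _ ⟨b, ⟨hb, hbx⟩, rfl⟩
    rw [dist_eq_norm]
    refine (norm_flow_sub_le hA ha hb ht).trans_lt ?_
    rw [← dist_eq_norm]
    exact (dist_triangle_right a b x).trans_lt (by
      linarith [Metric.mem_ball.1 hax, Metric.mem_ball.1 hbx])
  obtain ⟨y, hy⟩ := CompleteSpace.complete hc
  exact (tendsto_extendFrom ⟨y, Tendsto.congr' heq.symm hy⟩).congr' heq

theorem norm_semigroup_sub_flow_le (hA : IsMaximalMonotone A) {x y : H}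
    (hx : x ∈ closure (domain A)) (hy : y ∈ domain A) {t : ℝ} (ht : 0 ≤ t) :
    ‖semigroup A t x - flow A y t‖ ≤ ‖x - y‖ := by
  have : (𝓝[domain A] x).NeBot := mem_closure_iff_nhdsWithin_neBot.1 hx
  refine le_of_tendsto_of_tendsto ((tendsto_semigroup hA hx ht).sub_const _).norm
    ((tendsto_id'.2 nhdsWithin_le_nhds).sub_const y).norm ?_
  filter_upwards [eventually_mem_nhdsWithin] with a ha using norm_flow_sub_le hA ha hy ht

theorem zeros_subset_domain {E : Type*} [NormedAddCommGroup E] {A : E → Set E} :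
    zeros A ⊆ domain A := fun _ hz => ⟨0, hz⟩

theorem flow_eq_self (hA : IsMaximalMonotone A) {z : H} (hz : z ∈ zeros A) {t : ℝ}
    (ht : 0 ≤ t) : flow A z t = z := by
  have h := norm_flow_sub_flow_le hA hz le_rfl ht
  rwa [norm_zero, mul_zero, norm_le_zero_iff, sub_eq_zero,
    flow_zero hA (zeros_subset_domain hz)] at h

theorem norm_semigroup_sub_le (hA : IsMaximalMonotone A) {x z : H}
    (hx : x ∈ closure (domain A)) (hz : z ∈ zeros A) {t : ℝ} (ht : 0 ≤ t) :
    ‖semigroup A t x - z‖ ≤ ‖x - z‖ := by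
  simpa only [flow_eq_self hA hz ht] using
    norm_semigroup_sub_flow_le hA hx (zeros_subset_domain hz) ht

/-- The distance of a trajectory to a zero of `A` does not increase. -/
theorem norm_semigroup_sub_antitoneOn (hA : IsMaximalMonotone A) {x z : H}
    (hx : x ∈ closure (domain A)) (hz : z ∈ zeros A) :
    AntitoneOn (fun t => ‖semigroup A t x - z‖) (Ici 0) := by
  intro s hs t ht hst
  have : (𝓝[domain A] x).NeBot := mem_closure_iff_nhdsWithin_neBot.1 hx
  refine le_of_tendsto_of_tendsto ((tendsto_semigroup hA hx ht).sub_const _).norm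
    ((tendsto_semigroup hA hx hs).sub_const _).norm ?_
  filter_upwards [eventually_mem_nhdsWithin] with y hy
  have h := norm_flow_sub_le hA (flow_mem_domain hA hy hs) (zeros_subset_domain hz)
    (sub_nonneg.2 hst)
  rwa [← flow_add hA hy hs (sub_nonneg.2 hst), add_sub_cancel,
    flow_eq_self hA hz (sub_nonneg.2 hst)] at h

theorem continuousOn_semigroup (hA : IsMaximalMonotone A) {x : H}
    (hx : x ∈ closure (domain A)) : ContinuousOn (fun t => semigroup A t x) (Ici 0) := by
  refine continuousOn_of_uniform_approx_of_continuousOn fun U hU => ?_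
  obtain ⟨ε, hε, hU⟩ := Metric.mem_uniformity_dist.1 hU
  obtain ⟨y, hy, hyx⟩ := Metric.mem_closure_iff.1 hx ε hε
  obtain ⟨z, hz⟩ := id hy
  refine ⟨flow A y, ?_, fun t ht => hU ?_⟩
  · refine (LipschitzOnWith.of_dist_le_mul (K := ‖z‖₊) fun a ha b hb => ?_).continuousOn
    rw [dist_eq_norm, Real.dist_eq, mul_comm]
    exact norm_flow_sub_flow_le hA hz hb ha
  · rw [dist_eq_norm] at hyx ⊢
    exact (norm_semigroup_sub_flow_le hA hx hy ht).trans_lt hyx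

theorem intervalIntegrable_semigroup (hA : IsMaximalMonotone A) {x : H}
    (hx : x ∈ closure (domain A)) {s t : ℝ} (hs : 0 ≤ s) (ht : 0 ≤ t) :
    IntervalIntegrable (fun r => semigroup A r x) volume s t :=
  ((continuousOn_semigroup hA hx).mono fun _ hr => (le_min hs ht).trans hr.1).intervalIntegrable

theorem intervalIntegrable_inner_semigroup (hA : IsMaximalMonotone A) {x : H}
    (hx : x ∈ closure (domain A)) (q : H) {s t : ℝ} (hs : 0 ≤ s) (ht : 0 ≤ t) :
    IntervalIntegrable (fun r => inner ℝ q (semigroup A r x)) volume s t :=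
  (continuousOn_const.inner ((continuousOn_semigroup hA hx).mono
    fun _ hr => (le_min hs ht).trans hr.1)).intervalIntegrable

theorem integral_inner_semigroup (hA : IsMaximalMonotone A) {x : H}
    (hx : x ∈ closure (domain A)) (q : H) {t : ℝ} (ht : 0 < t) :
    ∫ s in (0 : ℝ)..t, inner ℝ q (semigroup A s x) = t * inner ℝ q (average A t x) := by
  have h := (innerSL ℝ q).intervalIntegral_comp_comm
    (intervalIntegrable_semigroup hA hx le_rfl ht.le)
  simp only [innerSL_apply_apply] at h
  rw [h, average, real_inner_smul_right, ← mul_assoc, mul_one_div_cancel ht.ne', one_mul]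

/-- The integral inequality for trajectories starting in the closure of the domain, divided
by `2 t`. -/
theorem neg_le_inner_average (hA : IsMaximalMonotone A) {x y q : H}
    (hx : x ∈ closure (domain A)) (hq : q ∈ A y) {t : ℝ} (ht : 0 < t) :
    -(‖x - y‖ ^ 2 / (2 * t)) ≤ inner ℝ q (y - average A t x) := by
  have : (𝓝[domain A] x).NeBot := mem_closure_iff_nhdsWithin_neBot.1 hx
  have hid : Tendsto (fun a : H => a) (𝓝[domain A] x) (𝓝 x) := tendsto_id'.2 nhdsWithin_le_nhds
  have key : ∀ᶠ a in 𝓝[domain A] x, -‖a - y‖ ^ 2 ≤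
      2 * t * inner ℝ q (y - average A t x) + 2 * t * (‖q‖ * ‖x - a‖) := by
    filter_upwards [eventually_mem_nhdsWithin] with a ha
    have hsol := isSolution_flow hA ha
    have h1 := hsol.energy_le hA.1 hq ht.le
    have hint1 : IntervalIntegrable (fun s => 2 * inner ℝ q (y - flow A a s)) volume 0 t := by
      refine ContinuousOn.intervalIntegrable ?_
      rw [uIcc_of_le ht.le]
      exact continuousOn_const.mul
        (continuousOn_const.inner (continuousOn_const.sub (hsol.continuousOn ht.le)))
    have hint2 := intervalIntegrable_inner_semigroup hA hx q le_rfl ht.le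
    have hint3 : IntervalIntegrable (fun s => 2 * (inner ℝ q y + ‖q‖ * ‖x - a‖) -
        2 * inner ℝ q (semigroup A s x)) volume 0 t :=
      intervalIntegrable_const.sub (hint2.const_mul 2)
    have h2 := intervalIntegral.integral_mono_on ht.le hint1 hint3 (fun s hs => by
      have h := (real_inner_le_norm q (semigroup A s x - flow A a s)).trans
        (mul_le_mul_of_nonneg_left (norm_semigroup_sub_flow_le hA hx ha hs.1) (norm_nonneg q))
      rw [inner_sub_right] at h ⊢
      linarith)
    rw [intervalIntegral.integral_sub intervalIntegrable_const (hint2.const_mul 2),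
      intervalIntegral.integral_const,
      intervalIntegral.integral_const_mul 2 fun s => inner ℝ q (semigroup A s x),
      integral_inner_semigroup hA hx q ht, sub_zero, smul_eq_mul] at h2
    rw [inner_sub_right]
    nlinarith [sq_nonneg ‖flow A a t - y‖]
  have hlim := le_of_tendsto_of_tendsto ((hid.sub_const y).norm.pow 2).neg
    (((((hid.const_sub x).norm).const_mul ‖q‖).const_mul (2 * t)).const_add _) key
  rw [sub_self, norm_zero, mul_zero, mul_zero, add_zero] at hlim
  rw [← neg_div, div_le_iff₀ (by positivity)]
  linarith

end

section

variable {H : Type*} [NormedAddCommGroup H] [InnerProductSpace ℝ H] [CompleteSpace H]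
  {A : H → Set H}

/-! ### Projections onto the set of zeros -/

/-- The projection and its variational inequality. -/
theorem proj_spec {C : Set H} (hne : C.Nonempty) (hcl : IsClosed C) (hconv : Convex ℝ C) (x : H) :
    proj C x ∈ C ∧ ∀ z ∈ C, inner ℝ (x - proj C x) (z - proj C x) ≤ 0 := by
  have hbdd : BddBelow (range fun w : C => ‖x - w‖) :=
    ⟨0, forall_mem_range.2 fun _ => norm_nonneg _⟩
  have hex : ∃ y, y ∈ C ∧ ∀ z ∈ C, ‖x - y‖ ≤ ‖x - z‖ := by
    obtain ⟨y, hy, hmin⟩ := exists_norm_eq_iInf_of_complete_convex hne hcl.isComplete hconv x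
    exact ⟨y, hy, fun z hz => hmin.trans_le (ciInf_le hbdd ⟨z, hz⟩)⟩
  have hp : proj C x ∈ C ∧ ∀ z ∈ C, ‖x - proj C x‖ ≤ ‖x - z‖ := Classical.epsilon_spec hex
  have : Nonempty C := hne.to_subtype
  exact ⟨hp.1, (norm_eq_iInf_iff_real_inner_le_zero hconv hp.1).1
    (le_antisymm (le_ciInf fun z => hp.2 z z.2) (ciInf_le hbdd ⟨_, hp.1⟩))⟩

theorem proj_zeros_spec (hA : IsMaximalMonotone A) (hS : (zeros A).Nonempty) (x : H) :
    proj (zeros A) x ∈ zeros A ∧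
      ∀ z ∈ zeros A, inner ℝ (x - proj (zeros A) x) (z - proj (zeros A) x) ≤ 0 := by
  have hset : zeros A = ⋂ (y : H) (z ∈ A y), {x | 0 ≤ inner ℝ (0 - z) (x - y)} := by
    ext w
    simp only [mem_iInter]
    exact hA.mem_iff
  refine proj_spec hS ?_ ?_ x
  · rw [hset]
    refine isClosed_iInter fun y => isClosed_iInter fun z => isClosed_iInter fun _ => ?_
    exact isClosed_le continuous_const (by fun_prop)
  · rw [hset]
    refine convex_iInter fun y => convex_iInter fun z => convex_iInter fun _ => ?_
    intro a ha b hb α β hα hβ hαβ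
    have e : α • a + β • b - y = α • (a - y) + β • (b - y) := by
      obtain rfl : β = 1 - α := by linarith
      module
    change 0 ≤ inner ℝ (0 - z) (α • a + β • b - y)
    rw [e, inner_add_right, real_inner_smul_right, real_inner_smul_right]
    exact add_nonneg (mul_nonneg hα ha) (mul_nonneg hβ hb)

/-- The projections on the zeros of a trajectory form a Cauchy family: the squared distance
between two of them is at most the decrease of the squared distance of the trajectory to the set
of zeros. -/
theorem norm_proj_semigroup_sub_sq_le (hA : IsMaximalMonotone A) (hS : (zeros A).Nonempty)
    {x : H} (hx : x ∈ closure (domain A)) {s t : ℝ} (hs : 0 ≤ s) (hst : s ≤ t) :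
    ‖proj (zeros A) (semigroup A t x) - proj (zeros A) (semigroup A s x)‖ ^ 2 ≤
      ‖semigroup A s x - proj (zeros A) (semigroup A s x)‖ ^ 2 -
        ‖semigroup A t x - proj (zeros A) (semigroup A t x)‖ ^ 2 := by
  obtain ⟨hps, -⟩ := proj_zeros_spec hA hS (semigroup A s x)
  obtain ⟨-, ht⟩ := proj_zeros_spec hA hS (semigroup A t x)
  set p := proj (zeros A) (semigroup A s x)
  set q := proj (zeros A) (semigroup A t x)
  have h1 := pow_le_pow_left₀ (norm_nonneg _)
    (norm_semigroup_sub_antitoneOn hA hx hps hs (hs.trans hst) hst) 2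
  simp only at h1
  have h2 := ht p hps
  have e : semigroup A t x - p = (semigroup A t x - q) - (p - q) := by abel
  rw [e, norm_sub_sq_real] at h1
  rw [norm_sub_rev q p]
  linarith

theorem exists_tendsto_proj_semigroup (hA : IsMaximalMonotone A) (hS : (zeros A).Nonempty)
    {x : H} (hx : x ∈ closure (domain A)) :
    ∃ v, Tendsto (fun t => proj (zeros A) (semigroup A t x)) atTop (𝓝 v) := by
  let p : ℝ → H := fun t => proj (zeros A) (semigroup A t x)
  -- Only times `t ≥ 0` are meaningful; `max t 0` makes the distance antitone on all of `ℝ`.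
  let g : ℝ → ℝ := fun t => ‖semigroup A (max t 0) x - p (max t 0)‖ ^ 2
  have hg : Antitone g := fun s t hst => by
    have := norm_proj_semigroup_sub_sq_le hA hS hx (le_max_right s 0) (max_le_max_right 0 hst)
    exact sub_nonneg.1 ((sq_nonneg _).trans this)
  have hlim := tendsto_atTop_ciInf hg ⟨0, forall_mem_range.2 fun t => sq_nonneg _⟩
  have hle : ∀ t, ⨅ s, g s ≤ g t := ciInf_le ⟨0, forall_mem_range.2 fun t => sq_nonneg _⟩
  have hc : CauchySeq p := by
    refine Metric.cauchySeq_iff'.2 fun ε hε => ?_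
    obtain ⟨N, hN, hN0⟩ := ((hlim.eventually (gt_mem_nhds
      (lt_add_of_pos_right _ (pow_pos hε 2)))).and (eventually_ge_atTop 0)).exists
    refine ⟨N, fun t ht => ?_⟩
    have h := norm_proj_semigroup_sub_sq_le hA hS hx hN0 ht
    have h1 : g N = ‖semigroup A N x - p N‖ ^ 2 := by simp only [g, max_eq_left hN0]
    have h2 : g t = ‖semigroup A t x - p t‖ ^ 2 := by simp only [g, max_eq_left (hN0.trans ht)]
    change ‖p t - p N‖ ^ 2 ≤ ‖semigroup A N x - p N‖ ^ 2 - ‖semigroup A t x - p t‖ ^ 2 at h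
    rw [← h1, ← h2] at h
    rw [dist_eq_norm]
    exact lt_of_pow_lt_pow_left₀ 2 hε.le (by linarith [hle t])
  exact cauchySeq_tendsto_of_complete hc

/-! ### Weak convergence of the averages -/

/-- A limit point of the averages of a function that is eventually at most `c` is at most `c`. -/
theorem le_of_tendsto_integral_average {f : ℝ → ℝ} {l : Filter ℝ} [l.NeBot] (hl : l ≤ atTop)
    (hf : ∀ s t : ℝ, 0 ≤ s → 0 ≤ t → IntervalIntegrable f volume s t) {b c : ℝ}
    (hb : Tendsto (fun t => (1 / t) * ∫ s in (0 : ℝ)..t, f s) l (𝓝 b))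
    (hc : ∀ᶠ s in atTop, f s ≤ c) : b ≤ c := by
  obtain ⟨T, hT⟩ := eventually_atTop.1 (hc.and (eventually_ge_atTop 0))
  have hT0 : 0 ≤ T := (hT T le_rfl).2
  set C := ∫ s in (0 : ℝ)..T, f s with hC
  have hlim : Tendsto (fun t : ℝ => c + t⁻¹ * (C - T * c)) l (𝓝 (c + 0 * (C - T * c))) :=
    ((tendsto_inv_atTop_zero.mono_left hl).mul_const _).const_add _
  rw [zero_mul, add_zero] at hlim
  refine le_of_tendsto_of_tendsto hb hlim (hl ?_)
  filter_upwards [eventually_ge_atTop T, eventually_gt_atTop 0] with t ht ht0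
  have h1 := intervalIntegral.integral_mono_on ht (hf T t hT0 ht0.le)
    (intervalIntegrable_const (c := c)) (fun s hs => (hT s hs.1).1)
  rw [intervalIntegral.integral_const, smul_eq_mul] at h1
  rw [← intervalIntegral.integral_add_adjacent_intervals (hf 0 T le_rfl hT0) (hf T t hT0 ht0.le),
    ← hC, one_div, inv_mul_le_iff₀ ht0, mul_add, mul_inv_cancel_left₀ ht0.ne']
  linarith

theorem norm_average_le (hA : IsMaximalMonotone A) {x z : H} (hx : x ∈ closure (domain A))
    (hz : z ∈ zeros A) {t : ℝ} (ht : 0 < t) : ‖average A t x‖ ≤ ‖x - z‖ + ‖z‖ := by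
  have h := intervalIntegral.norm_integral_le_of_norm_le_const (a := 0) (b := t)
    (f := fun s => semigroup A s x) (C := ‖x - z‖ + ‖z‖) (fun s hs => by
      rw [uIoc_of_le ht.le] at hs
      have h1 := norm_semigroup_sub_le hA hx hz hs.1.le
      have h2 := norm_add_le (semigroup A s x - z) z
      rw [sub_add_cancel] at h2
      linarith)
  rw [sub_zero, abs_of_pos ht] at h
  rw [average, norm_smul, Real.norm_of_nonneg (by positivity), one_div, inv_mul_le_iff₀ ht]
  linarith

/-- Weak limit points of the averages are zeros of `A`: by the integral inequality they are
monotonically related, with value `0`, to the whole graph. -/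
theorem mem_zeros_of_weak_limit_average (hA : IsMaximalMonotone A) {x w : H}
    (hx : x ∈ closure (domain A)) {l : Filter ℝ} [l.NeBot] (hl : l ≤ atTop)
    (hw : ∀ y, Tendsto (fun t => inner ℝ (average A t x) y) l (𝓝 (inner ℝ w y))) :
    w ∈ zeros A := by
  refine hA.mem_of_forall fun y q hq => ?_
  have h1 : Tendsto (fun t : ℝ => -(‖x - y‖ ^ 2 / (2 * t))) l (𝓝 (-0)) :=
    ((tendsto_id.const_mul_atTop (zero_lt_two (α := ℝ))).const_div_atTop _ |>.mono_left hl).neg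
  have h2 : Tendsto (fun t => inner ℝ q (y - average A t x)) l (𝓝 (inner ℝ q (y - w))) := by
    simpa only [real_inner_comm q, inner_sub_right] using (hw q).const_sub (inner ℝ q y)
  have h := le_of_tendsto_of_tendsto h1 h2 (hl <| by
    filter_upwards [eventually_gt_atTop 0] with t ht using neg_le_inner_average hA hx hq ht)
  rw [neg_zero] at h
  rwa [zero_sub, ← neg_sub y w, inner_neg_neg]

/-- The strong limit of the projections is the only possible weak limit point of the averages. -/
theorem eq_of_weak_limit_average (hA : IsMaximalMonotone A) (hS : (zeros A).Nonempty) {x v w : H}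
    (hx : x ∈ closure (domain A))
    (hv : Tendsto (fun t => proj (zeros A) (semigroup A t x)) atTop (𝓝 v))
    {l : Filter ℝ} [l.NeBot] (hl : l ≤ atTop)
    (hw : ∀ y, Tendsto (fun t => inner ℝ (average A t x) y) l (𝓝 (inner ℝ w y))) : w = v := by
  have hwS := mem_zeros_of_weak_limit_average hA hx hl hw
  set p : ℝ → H := fun t => proj (zeros A) (semigroup A t x)
  set D := ‖semigroup A 0 x - p 0‖
  -- The variational inequality of the projection, tested with the zero `w`.
  have hpt : ∀ t : ℝ, 0 ≤ t →
      inner ℝ (w - v) (semigroup A t x) ≤ inner ℝ (w - v) (p t) + D * ‖p t - v‖ := by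
    intro t ht
    have h1 : inner ℝ (semigroup A t x - p t) (w - p t) ≤ 0 := (proj_zeros_spec hA hS _).2 w hwS
    have h2 : ‖semigroup A t x - p t‖ ≤ D := by
      have h := norm_proj_semigroup_sub_sq_le hA hS hx le_rfl ht
      exact le_of_sq_le_sq (sub_nonneg.1 ((sq_nonneg _).trans h)) (norm_nonneg _)
    have h3 := (real_inner_le_norm (semigroup A t x - p t) (p t - v)).trans
      (mul_le_mul_of_nonneg_right h2 (norm_nonneg _))
    have e : inner ℝ (w - v) (semigroup A t x) = inner ℝ (w - v) (p t) +
        (inner ℝ (semigroup A t x - p t) (w - p t) +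
          inner ℝ (semigroup A t x - p t) (p t - v)) := by
      rw [← inner_add_right, sub_add_sub_cancel, real_inner_comm, real_inner_comm _ (w - v),
        ← inner_add_left, add_sub_cancel]
    linarith
  have hub : Tendsto (fun t => inner ℝ (w - v) (p t) + D * ‖p t - v‖) atTop
      (𝓝 (inner ℝ (w - v) v)) := by
    simpa using (tendsto_const_nhds.inner hv).add
      ((tendsto_iff_norm_sub_tendsto_zero.1 hv).const_mul D)
  have hav : Tendsto (fun t => (1 / t) * ∫ s in (0 : ℝ)..t, inner ℝ (w - v) (semigroup A s x)) l
      (𝓝 (inner ℝ w (w - v))) := by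
    refine (hw (w - v)).congr' (hl ?_)
    filter_upwards [eventually_gt_atTop 0] with t ht
    rw [integral_inner_semigroup hA hx _ ht, ← mul_assoc, one_div_mul_cancel ht.ne', one_mul,
      real_inner_comm]
  have hle : inner ℝ w (w - v) ≤ inner ℝ (w - v) v := by
    refine le_of_forall_pos_le_add fun ε hε => ?_
    refine le_of_tendsto_integral_average hl
      (fun s t hs ht => intervalIntegrable_inner_semigroup hA hx _ hs ht) hav ?_
    filter_upwards [hub.eventually (gt_mem_nhds (lt_add_of_pos_right _ hε)),
      eventually_ge_atTop 0] with t h1 h2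
    exact (hpt t h2).trans h1.le
  rw [real_inner_comm, ← sub_nonpos, ← inner_sub_right, real_inner_self_eq_norm_sq] at hle
  exact sub_eq_zero.1 (norm_eq_zero.1 (pow_eq_zero_iff two_ne_zero |>.1
    (le_antisymm hle (sq_nonneg _))))

theorem tendsto_inner_average (hA : IsMaximalMonotone A) (hS : (zeros A).Nonempty) {x v : H}
    (hx : x ∈ closure (domain A))
    (hv : Tendsto (fun t => proj (zeros A) (semigroup A t x)) atTop (𝓝 v)) (y : H) :
    Tendsto (fun t => inner ℝ (average A t x) y) atTop (𝓝 (inner ℝ v y)) := by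
  obtain ⟨z, hz⟩ := id hS
  rw [tendsto_iff_ultrafilter]
  intro l hl
  obtain ⟨w, -, hw⟩ := exists_weak_limit l (fun t => average A t x) (M := ‖x - z‖ + ‖z‖) (hl <| by
    filter_upwards [eventually_gt_atTop 0] with t ht using norm_average_le hA hx hz ht)
  rw [← eq_of_weak_limit_average hA hS hx hv hl hw]
  exact hw y

theorem tendsto_toWeakSpace_of_inner {ι : Type*} {l : Filter ι} {f : ι → H} {v : H}
    (h : ∀ y, Tendsto (fun i => inner ℝ (f i) y) l (𝓝 (inner ℝ v y))) :
    Tendsto (fun i => toWeakSpace ℝ H (f i)) l (𝓝 (toWeakSpace ℝ H v)) := by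
  refine (WeakBilin.tendsto_iff_forall_eval_tendsto (topDualPairing ℝ H).flip ?_).2 fun φ => ?_
  · exact fun a b hab => ext_inner_left ℝ fun z => LinearMap.congr_fun hab (innerSL ℝ z)
  · have := h ((InnerProductSpace.toDual ℝ H).symm φ)
    simp only [real_inner_comm ((InnerProductSpace.toDual ℝ H).symm φ),
      InnerProductSpace.toDual_symm_apply] at this
    exact this

end

end MonotoneOperator

end

theorem mainTheorem4 {H : Type*} [NormedAddCommGroup H] [InnerProductSpace ℝ H] [CompleteSpace H]
    (A : H → Set H) (hA : MonotoneOperator.IsMaximalMonotone A)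
    (hS : (MonotoneOperator.zeros A).Nonempty)
    (x : H) (hx : x ∈ closure (MonotoneOperator.domain A)) :
    (∀ t : ℝ, 0 < t →
      IntervalIntegrable (fun s => MonotoneOperator.semigroup A s x) volume 0 t) ∧
    ∃ v : H,
      Tendsto (fun t : ℝ =>
          MonotoneOperator.proj (MonotoneOperator.zeros A) (MonotoneOperator.semigroup A t x))
        atTop (𝓝 v) ∧
      Tendsto (fun t : ℝ => toWeakSpace ℝ H (MonotoneOperator.average A t x))
        atTop (𝓝 (toWeakSpace ℝ H v)) := by
  refine ⟨fun t ht => MonotoneOperator.intervalIntegrable_semigroup hA hx le_rfl ht.le, ?_⟩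
  obtain ⟨v, hv⟩ := MonotoneOperator.exists_tendsto_proj_semigroup hA hS hx
  exact ⟨v, hv, MonotoneOperator.tendsto_toWeakSpace_of_inner
    (MonotoneOperator.tendsto_inner_average hA hS hx hv)⟩
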